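/- Let $F$ be a finite field with $q$ elements, let $V$ be a vector space over $F$ of finite dimension $v$, and let $k \ge 1$ be an integer with $v \ge 2k$. The $q$-Kneser graph $qK_{v:k}$ has the $k$-dimensional subspaces of $V$ as its vertices, two of them being adjacent if their intersection is the zero subspace. For $n \ge 0$ put $[n] = \frac{q^n-1}{q-1}$, $[0]! = 1$ and $[n+1]! = [n+1]\,[n]!$, and for $0 \le m \le n$ let $\begin{bmatrix} n \\ m \end{bmatrix}_q = \frac{[n]!}{[m]!\,[n-m]!}$. Let $W_{1,k}(v)$ be the real $01$-matrix with rows indexed by the $1$-dimensional subspaces and columns indexed by the $k$-dimensional subspaces of $V$, whose $(L,U)$-entry is $1$ if and only if $L \subseteq U$. Then the maximum size of an independent set in $qK_{v:k}$ is $$\begin{bmatrix} v-1 \\ k-1 \end{bmatrix}_q .$$ Moreover, if $S$ is an independent set in $qK_{v:k}$ of this size, then the characteristic vector of $S$ (the real vector indexed by the $k$-dimensional subspaces of $V$ with entry $1$ on $S$ and $0$ elsewhere) lies in the column space over $\mathbb{R}$ of $W_{1,k}(v)^T$. -/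

import Mathlib

noncomputable section

/-- The `q`-integer `[n] = (q ^ n - 1) / (q - 1)`, as a rational number (meaningful for `q ≠ 1`). -/
def qInt (q n : ℕ) : ℚ := ((q : ℚ) ^ n - 1) / ((q : ℚ) - 1)

/-- The `q`-factorial: `[0]! = 1` and `[n + 1]! = [n + 1] [n]!`. -/
def qFactorial (q : ℕ) : ℕ → ℚ
  | 0 => 1
  | n + 1 => qInt q (n + 1) * qFactorial q n

/-- The Gaussian binomial coefficient `[n choose k]_q = [n]! / ([k]! [n - k]!)`, for `k ≤ n`. -/
def qBinomial (q n k : ℕ) : ℚ :=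
  qFactorial q n / (qFactorial q k * qFactorial q (n - k))

/-- The type of `k`-dimensional subspaces of `V`. -/
abbrev KSubspace (F V : Type*) [Field F] [AddCommGroup V] [Module F V] (k : ℕ) :=
  {U : Submodule F V // Module.finrank F U = k}

/-- The `q`-Kneser graph: the vertices are the `k`-subspaces of `V`, and two of them are adjacent
when they intersect in the zero subspace. (For `k ≥ 1` such subspaces are automatically distinct;
the condition `U ≠ W` only removes the loop that would appear for `k = 0`.) -/
def qKneserGraph (F V : Type*) [Field F] [AddCommGroup V] [Module F V] (k : ℕ) :
    SimpleGraph (KSubspace F V k) where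
  Adj U W := U ≠ W ∧ (U : Submodule F V) ⊓ (W : Submodule F V) = ⊥
  symm := ⟨fun _ _ h => ⟨h.1.symm, by rw [inf_comm]; exact h.2⟩⟩
  loopless := ⟨fun _ h => h.1 rfl⟩

open Classical in
/-- The 01-matrix `W_{1,k}` with rows indexed by the 1-dimensional subspaces and columns by the
`k`-dimensional subspaces of `V`, whose entry is `1` exactly when the former is contained in the
latter. -/
def inclusionMatrix (F V : Type*) [Field F] [AddCommGroup V] [Module F V] (k : ℕ) :
    Matrix (KSubspace F V 1) (KSubspace F V k) ℝ :=
  Matrix.of fun L U => if (L : Submodule F V) ≤ (U : Submodule F V) then 1 else 0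

/-- The column space of a real matrix: the span of its columns. -/
def columnSpace {m n : Type*} (M : Matrix m n ℝ) : Submodule ℝ (m → ℝ) :=
  Submodule.span ℝ (Set.range M.col)

/-- The characteristic vector of a finite set. -/
def charVector {α : Type*} (S : Finset α) : α → ℝ := Set.indicator (S : Set α) 1

end

/-! This is Hoffman's ratio bound. Let `A` be the disjointness matrix of the `k`-subspaces, `J` the
all-ones matrix, `c` the number of `k`-subspaces through a fixed line and `τ = extensionCount q v k
k 1`. If `M = A + τ I - (τ/c) J` is positive semidefinite, the characteristic vector of an
independent `S` gives `0 ≤ τ|S| - (τ/c)|S|²`, so `|S| ≤ c`. Equality puts that vector in `ker M`.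
The `k`-subspaces through a line attain the bound.

The spectrum comes from harmonic functions. Functions on `k`-subspaces are spanned by the lifts of
harmonic functions of degrees `j ≤ k` (`iSup_map_harmonic`). Möbius inversion shows that `A` acts on
degree `j` by `(-1)^j q^(j choose 2) extensionCount q v k k j` (`disjointMatrix_mulVec`). In degree
1 this is `-τ`. In degrees `j ≥ 2` its absolute value is below `τ`, because `v ≥ 2k`. The `J` term
cancels degree 0. So `M` has eigenvalue 0 in degrees 0 and 1 and positive eigenvalues above, and
`ker M` lies in the span of the rows of `W_{1,k}`.

Neither dimensions of the eigenspaces nor directness of their sum is needed, only that they span. -/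

section Auxiliary

open Module Finset
open scoped Classical

/-- The number of `k`-subspaces of a `v`-dimensional space that contain a given `j`-subspace and
meet trivially a given `u`-subspace, the latter two being disjoint. -/
noncomputable def extensionCount (q v k u j : ℕ) : ℝ :=
  ∏ i ∈ Ico j k, ((q : ℝ) ^ v - (q : ℝ) ^ (i + u)) / ((q : ℝ) ^ k - (q : ℝ) ^ i)

/-- The Möbius function of the subspace lattice, as a function of the dimension. -/
noncomputable def subspaceMoebius (q i : ℕ) : ℝ := (-1) ^ i * (q : ℝ) ^ (i.choose 2)

/-! ### Counting subspaces and Möbius inversion -/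

section Counting

variable {F V : Type*} [Field F] [Finite F] [AddCommGroup V] [Module F V] [FiniteDimensional F V]

lemma one_lt_natCard_real (F : Type*) [Field F] [Finite F] : (1 : ℝ) < (Nat.card F : ℝ) := by
  exact_mod_cast Finite.one_lt_card

omit [Finite F] in
lemma sum_mem_submodule [Fintype V] (W : Submodule F V) :
    ∑ x : V, (if x ∈ W then (1 : ℝ) else 0) = (Nat.card F : ℝ) ^ finrank F W := by
  rw [Finset.sum_boole, ← Nat.cast_pow, ← Module.natCard_eq_pow_finrank (K := F) (V := W),
    Nat.card_eq_fintype_card, Fintype.card_subtype]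

lemma extensionCount_self (q v k u : ℕ) : extensionCount q v k u k = 1 := by
  simp [extensionCount]

lemma extensionCount_succ {q k j : ℕ} (hq : 1 < (q : ℝ)) (v u : ℕ) (hj : j < k) :
    extensionCount q v k u j * ((q : ℝ) ^ k - (q : ℝ) ^ j) =
      extensionCount q v k u (j + 1) * ((q : ℝ) ^ v - (q : ℝ) ^ (j + u)) := by
  have : (q : ℝ) ^ k - (q : ℝ) ^ j ≠ 0 := (sub_pos.2 (pow_lt_pow_right₀ hq hj)).ne'
  rw [extensionCount, extensionCount, Finset.prod_eq_prod_Ico_succ_bot hj]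
  field_simp

omit [Finite F] in
lemma finrank_sup_span_singleton {T : Submodule F V} {x : V} (hx : x ∉ T) :
    finrank F (T ⊔ F ∙ x : Submodule F V) = finrank F T + 1 := by
  have h0 : x ≠ 0 := fun h => hx (h ▸ T.zero_mem)
  have h := Submodule.finrank_sup_add_finrank_inf_eq T (F ∙ x)
  have : T ⊓ (F ∙ x) = ⊥ := by
    rw [← disjoint_iff, Submodule.disjoint_span_singleton' h0]
    exact hx
  rw [this, finrank_bot, finrank_span_singleton h0] at h
  simpa using h

omit [Finite F] [FiniteDimensional F V] in
lemma sup_span_singleton_inf_eq_bot {T U : Submodule F V} (hTU : T ⊓ U = ⊥) {x : V}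
    (hx : x ∉ T ⊔ U) : (T ⊔ F ∙ x) ⊓ U = ⊥ := by
  have h0 : x ≠ 0 := fun h => hx (h ▸ Submodule.zero_mem _)
  rw [← disjoint_iff] at hTU ⊢
  have : Disjoint (T ⊔ U) (F ∙ x) := (Submodule.disjoint_span_singleton' h0).2 hx
  have h2 : Disjoint U (T ⊔ F ∙ x) := hTU.symm.disjoint_sup_right_of_disjoint_sup_left
    (by rwa [sup_comm U T])
  exact h2.symm

/-- Induction on `k - dim T`, double counting pairs `(W, x)` with `x ∈ W \ T`. Each `W` has `q^k -
q^(dim T)` such `x`. Only `x ∈ X \ (T ⊔ U)` occur, and for those the `W` are the extensions of `T ⊔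
F ∙ x`. -/
lemma card_extensions [Fintype (Submodule F V)] (X U : Submodule F V) (hU : U ≤ X) (k : ℕ)
    (T : Submodule F V) (hT : T ≤ X) (hTU : T ⊓ U = ⊥) (hk : finrank F T ≤ k) :
    (#{W : Submodule F V | finrank F W = k ∧ T ≤ W ∧ W ≤ X ∧ W ⊓ U = ⊥} : ℝ) =
      extensionCount (Nat.card F) (finrank F X) k (finrank F U) (finrank F T) := by
  have : Finite V := Module.finite_of_finite F
  have := Fintype.ofFinite V
  obtain ⟨n, hn⟩ : ∃ n, n = k - finrank F T := ⟨_, rfl⟩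
  induction n generalizing T with
  | zero =>
    have hkT : k = finrank F T := by omega
    subst hkT
    rw [extensionCount_self]
    have : ({W : Submodule F V | finrank F W = finrank F T ∧ T ≤ W ∧ W ≤ X ∧ W ⊓ U = ⊥} :
        Finset _) = {T} := by
      ext W
      simp only [mem_filter, mem_univ, true_and, mem_singleton]
      constructor
      · rintro ⟨h1, h2, -⟩
        exact (Submodule.eq_of_le_of_finrank_eq h2 h1.symm).symm
      · rintro rfl
        exact ⟨rfl, le_rfl, hT, hTU⟩
    simp [this]
  | succ n ih =>
    have hlt : finrank F T < k := by omega
    have hq := one_lt_natCard_real F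
    set q : ℝ := (Nat.card F : ℝ) with hqdef
    have hpos : q ^ k - q ^ finrank F T ≠ 0 := (sub_pos.2 (pow_lt_pow_right₀ hq hlt)).ne'
    apply mul_right_cancel₀ hpos
    rw [extensionCount_succ hq _ _ hlt]
    set C : Finset (Submodule F V) :=
      {W : Submodule F V | finrank F W = k ∧ T ≤ W ∧ W ≤ X ∧ W ⊓ U = ⊥} with hC
    have h1 : ∑ W ∈ C, ∑ x : V, ((if x ∈ W then (1 : ℝ) else 0) - if x ∈ T then 1 else 0) =
        (#C : ℝ) * (q ^ k - q ^ finrank F T) := by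
      rw [← nsmul_eq_mul, ← Finset.sum_const]
      refine Finset.sum_congr rfl fun W hW => ?_
      rw [Finset.sum_sub_distrib, sum_mem_submodule, sum_mem_submodule]
      simp only [hC, mem_filter, mem_univ, true_and] at hW
      rw [hW.1]
    rw [← h1, Finset.sum_comm]
    have hdim : finrank F (T ⊔ U : Submodule F V) = finrank F T + finrank F U := by
      have := Submodule.finrank_sup_add_finrank_inf_eq T U
      rw [hTU, finrank_bot] at this
      simpa using this
    have h2 : ∀ x : V, ∑ W ∈ C, ((if x ∈ W then (1 : ℝ) else 0) - if x ∈ T then 1 else 0) =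
        extensionCount (Nat.card F) (finrank F X) k (finrank F U) (finrank F T + 1) *
          ((if x ∈ X then 1 else 0) - if x ∈ T ⊔ U then 1 else 0) := by
      intro x
      by_cases hxT : x ∈ T
      · rw [Finset.sum_eq_zero]
        · simp [hT hxT, Submodule.mem_sup_left hxT]
        · intro W hW
          simp only [hC, mem_filter, mem_univ, true_and] at hW
          simp [hxT, hW.2.1 hxT]
      simp only [hxT, if_false, sub_zero]
      rw [Finset.sum_boole]
      by_cases hxX : x ∈ X
      swap
      · have : x ∉ T ⊔ U := fun h => hxX (sup_le hT hU h)
        simp only [hxX, this, if_false, sub_zero, mul_zero, Nat.cast_eq_zero, card_eq_zero]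
        refine Finset.filter_eq_empty_iff.2 fun W hW hxW => hxX ?_
        simp only [hC, mem_filter, mem_univ, true_and] at hW
        exact hW.2.2.1 hxW
      by_cases hxTU : x ∈ T ⊔ U
      · simp only [hxX, hxTU, if_true, sub_self, mul_zero, Nat.cast_eq_zero, card_eq_zero]
        refine Finset.filter_eq_empty_iff.2 fun W hW hxW => hxT ?_
        simp only [hC, mem_filter, mem_univ, true_and] at hW
        -- If `x = t + u` lies in `W`, then `u ∈ W ⊓ U = ⊥`, which forces `x ∈ T`.
        obtain ⟨t, ht, u, hu, rfl⟩ := Submodule.mem_sup.1 hxTU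
        have huW : u ∈ W := by simpa using W.sub_mem hxW (hW.2.1 ht)
        have : u ∈ W ⊓ U := ⟨huW, hu⟩
        rw [hW.2.2.2, Submodule.mem_bot] at this
        simpa [this] using ht
      · have hr := finrank_sup_span_singleton hxT
        have := ih (T ⊔ F ∙ x) (sup_le hT (by simpa using hxX))
          (sup_span_singleton_inf_eq_bot hTU hxTU) (by omega) (by omega)
        rw [hr] at this
        simp only [hxX, hxTU, if_true, if_false, sub_zero, mul_one]
        rw [← this, hC, Finset.filter_filter]
        congr 2
        ext W
        simp only [mem_filter, mem_univ, true_and, sup_le_iff, Submodule.span_singleton_le_iff_mem]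
        tauto
    rw [Finset.sum_congr rfl fun x _ => h2 x, ← Finset.mul_sum, Finset.sum_sub_distrib,
      sum_mem_submodule, sum_mem_submodule, hdim]

lemma subspaceMoebius_succ (q i : ℕ) :
    subspaceMoebius q (i + 1) = -((q : ℝ) ^ i * subspaceMoebius q i) := by
  simp only [subspaceMoebius, Nat.choose_succ_succ' i 1, Nat.choose_one_right, pow_add, pow_one]
  ring

lemma extensionCount_hyperplane {q : ℕ} (hq : 1 < (q : ℝ)) (i : ℕ) :
    extensionCount q (i + 1) i 1 0 = (q : ℝ) ^ i := by
  rw [extensionCount, Finset.prod_congr rfl (g := fun _ => (q : ℝ)), Finset.prod_const]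
  · simp
  · intro a ha
    have : (q : ℝ) ^ i - (q : ℝ) ^ a ≠ 0 :=
      (sub_pos.2 (pow_lt_pow_right₀ hq (Finset.mem_Ico.1 ha).2)).ne'
    rw [div_eq_iff this]
    ring

/-- Fix a line `L ≤ X` and group the `P` by `Q = P ⊔ L`. If `dim Q = i + 1`, the group is `Q`
together with the `q^i` hyperplanes of `Q` that avoid `L`, and their contributions cancel. -/
lemma sum_subspaceMoebius [Fintype (Submodule F V)] (X : Submodule F V) :
    ∑ P : Submodule F V with P ≤ X, subspaceMoebius (Nat.card F) (finrank F P) =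
      if X = ⊥ then 1 else 0 := by
  split_ifs with hX
  · subst hX
    simp [le_bot_iff, Finset.filter_eq', subspaceMoebius]
  obtain ⟨x, hxX, hx0⟩ := Submodule.exists_mem_ne_zero_of_ne_bot hX
  set L : Submodule F V := F ∙ x with hL
  have hL1 : finrank F L = 1 := finrank_span_singleton hx0
  have hLX : L ≤ X := by simpa [hL] using hxX
  have hxL (P : Submodule F V) : L ≤ P ↔ x ∈ P := by simp [hL]
  rw [← Finset.sum_filter_add_sum_filter_not _ (fun P => L ≤ P)]
  have hmaps : ∀ P ∈ ({P : Submodule F V | P ≤ X} : Finset _).filter (fun P => ¬ L ≤ P),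
      P ⊔ L ∈ ({P : Submodule F V | P ≤ X} : Finset _).filter (fun P => L ≤ P) := by
    intro P hP
    simp only [mem_filter, mem_univ, true_and] at hP ⊢
    exact ⟨sup_le hP.1 hLX, le_sup_right⟩
  rw [← Finset.sum_fiberwise_of_maps_to hmaps, ← Finset.sum_add_distrib]
  refine Finset.sum_eq_zero fun Q hQ => ?_
  simp only [mem_filter, mem_univ, true_and] at hQ
  obtain ⟨i, hi⟩ : ∃ i, finrank F Q = i + 1 := by
    have := Submodule.finrank_mono hQ.2
    exact ⟨finrank F Q - 1, by omega⟩
  have hset : ((({P : Submodule F V | P ≤ X} : Finset _).filter (fun P => ¬ L ≤ P)).filter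
      (fun P => P ⊔ L = Q)) =
      ({P : Submodule F V | finrank F P = i ∧ ⊥ ≤ P ∧ P ≤ Q ∧ P ⊓ L = ⊥} : Finset _) := by
    ext P
    simp only [mem_filter, mem_univ, true_and, bot_le]
    have hd : P ⊓ L = ⊥ ↔ ¬ L ≤ P := by
      rw [← disjoint_iff, hL, Submodule.disjoint_span_singleton' hx0, ← hL, hxL]
    constructor
    · rintro ⟨⟨h1, h2⟩, h3⟩
      refine ⟨?_, h3 ▸ le_sup_left, hd.2 h2⟩
      have := finrank_sup_span_singleton ((hxL P).not.1 h2)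
      rw [← hL, h3] at this
      omega
    · rintro ⟨h1, h2, h3⟩
      have h4 := hd.1 h3
      refine ⟨⟨h2.trans hQ.1, h4⟩, ?_⟩
      have := finrank_sup_span_singleton ((hxL P).not.1 h4)
      exact Submodule.eq_of_le_of_finrank_eq (sup_le h2 hQ.2) (by rw [← hL] at this; omega)
  rw [hset, Finset.sum_congr rfl (g := fun _ => subspaceMoebius (Nat.card F) i), Finset.sum_const,
    nsmul_eq_mul, card_extensions Q L hQ.2 i ⊥ bot_le (by simp) (by simp), hL1, hi, finrank_bot,
    extensionCount_hyperplane (one_lt_natCard_real F), subspaceMoebius_succ]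
  · ring
  · intro P hP
    simp only [mem_filter, mem_univ, true_and] at hP
    rw [hP.1]

end Counting

/-! ### Harmonic functions and the eigenspaces of the disjointness matrix -/

section Harmonic

variable {F V : Type*} [Field F] [AddCommGroup V] [Module F V] [Fintype (Submodule F V)]

/-- The map sending a function on subspaces to the function on `k`-subspaces whose value at `U` is
the sum over the `j`-subspaces of `U`. -/
noncomputable def upMap (F V : Type*) [Field F] [AddCommGroup V] [Module F V] [Fintype (Submodule F V)]
    (j k : ℕ) : (Submodule F V → ℝ) →ₗ[ℝ] (KSubspace F V k → ℝ) where
  toFun h U := ∑ T ∈ {T : Submodule F V | finrank F T = j}, if T ≤ U.1 then h T else 0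
  map_add' f g := by
    ext U
    simp only [Pi.add_apply, ← Finset.sum_add_distrib]
    exact Finset.sum_congr rfl fun T _ => by split_ifs <;> simp
  map_smul' c f := by
    ext U
    simp [Finset.mul_sum]

lemma upMap_apply (j k : ℕ) (h : Submodule F V → ℝ) (U : KSubspace F V k) :
    upMap F V j k h U =
      ∑ T ∈ {T : Submodule F V | finrank F T = j}, if T ≤ U.1 then h T else 0 := rfl

/-- The functions on `j`-subspaces whose sum over the `j`-subspaces that contain a given subspace
of dimension less than `j` is zero. -/
noncomputable def harmonicFunctions (F V : Type*) [Field F] [AddCommGroup V] [Module F V] [Fintype (Submodule F V)]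
    (j : ℕ) : Submodule ℝ (Submodule F V → ℝ) where
  carrier := {h | ∀ P : Submodule F V, finrank F P < j →
    ∑ T ∈ {T : Submodule F V | finrank F T = j}, (if P ≤ T then h T else 0) = 0}
  add_mem' {f g} hf hg P hP := by
    have h := congrArg₂ (· + ·) (hf P hP) (hg P hP)
    simp only [← Finset.sum_add_distrib, add_zero] at h
    refine Eq.trans (Finset.sum_congr rfl fun T _ => ?_) h
    split_ifs <;> simp
  zero_mem' P _ := by simp
  smul_mem' c f hf P hP := by
    have := hf P hP
    simp only [Pi.smul_apply, smul_eq_mul, ← mul_ite_zero, ← Finset.mul_sum]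
    rw [this, mul_zero]

/-- The disjointness matrix of the `k`-subspaces. -/
noncomputable def disjointMatrix (F V : Type*) [Field F] [AddCommGroup V] [Module F V] (k : ℕ) :
    Matrix (KSubspace F V k) (KSubspace F V k) ℝ :=
  Matrix.of fun U W => if W.1 ⊓ U.1 = ⊥ then 1 else 0

lemma sum_kSubspace {k : ℕ} [Fintype (KSubspace F V k)] (g : Submodule F V → ℝ) :
    ∑ U : KSubspace F V k, g U.1 = ∑ U ∈ {U : Submodule F V | finrank F U = k}, g U :=
  (Finset.sum_subtype _ (fun x => by simp) g).symm

variable [Finite F] [FiniteDimensional F V]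

/-- Expand the indicator of `T ⊓ U = ⊥` as a Möbius sum over `P ≤ T ⊓ U` and swap the sums.
Harmonicity kills `dim P < j`, no `T` contains a `P` with `dim P > j`, and `dim P = j` leaves only
`T = P`. -/
lemma sum_moebius_harmonic {j : ℕ} {h : Submodule F V → ℝ} (hh : h ∈ harmonicFunctions F V j)
    (U : Submodule F V) :
    ∑ T ∈ {T : Submodule F V | finrank F T = j}, (if T ⊓ U = ⊥ then h T else 0) =
      subspaceMoebius (Nat.card F) j *
        ∑ T ∈ {T : Submodule F V | finrank F T = j}, (if T ≤ U then h T else 0) := by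
  have h1 : ∀ T : Submodule F V, (if T ⊓ U = ⊥ then h T else 0) =
      ∑ P : Submodule F V with P ≤ U, subspaceMoebius (Nat.card F) (finrank F P) *
        (if P ≤ T then h T else 0) := by
    intro T
    have := sum_subspaceMoebius (F := F) (T ⊓ U)
    rw [← mul_boole, mul_comm, ← this, Finset.sum_mul]
    simp only [mul_ite, mul_zero]
    rw [← Finset.sum_filter, Finset.filter_filter]
    refine Finset.sum_congr ?_ fun _ _ => rfl
    ext P
    simp [and_comm]
  rw [Finset.sum_congr rfl fun T _ => h1 T, Finset.sum_comm]
  simp only [← Finset.mul_sum]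
  rw [← Finset.sum_filter, Finset.filter_filter, Finset.mul_sum]
  symm
  apply Finset.sum_subset_zero_on_sdiff
  · intro P hP
    simp only [mem_filter, mem_univ, true_and] at hP ⊢
    exact hP.2
  · intro P hP
    simp only [mem_filter, mem_univ, true_and, mem_sdiff, not_and] at hP
    rcases lt_trichotomy (finrank F P) j with hlt | heq | hgt
    · rw [hh P hlt, mul_zero]
    · exact absurd hP.1 (hP.2 heq)
    · rw [Finset.sum_eq_zero, mul_zero]
      intro T hT
      simp only [mem_filter, mem_univ, true_and] at hT
      rw [if_neg]
      intro hPT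
      have := Submodule.finrank_mono hPT
      omega
  · intro P hP
    simp only [mem_filter, mem_univ, true_and] at hP
    rw [Finset.sum_eq_single P, if_pos le_rfl, hP.1]
    · intro T hT hTP
      simp only [mem_filter, mem_univ, true_and] at hT
      rw [if_neg]
      intro hPT
      exact hTP (Submodule.eq_of_le_of_finrank_eq hPT (hP.1.trans hT.symm)).symm
    · intro hn
      simp [hP.1] at hn

/-- The number of `W ≥ T` disjoint from `U` is zero unless `T ⊓ U = ⊥`, and is otherwise independent
of `T`. What remains is the sum evaluated by `sum_moebius_harmonic`. -/
lemma disjointMatrix_mulVec {k j : ℕ} [Fintype (KSubspace F V k)] (hjk : j ≤ k)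
    {h : Submodule F V → ℝ} (hh : h ∈ harmonicFunctions F V j) :
    (disjointMatrix F V k).mulVec (upMap F V j k h) =
      (subspaceMoebius (Nat.card F) j *
        extensionCount (Nat.card F) (finrank F V) k k j) • upMap F V j k h := by
  ext U
  rw [Pi.smul_apply, smul_eq_mul, upMap_apply, mul_right_comm, ← sum_moebius_harmonic hh]
  simp only [Matrix.mulVec, dotProduct, disjointMatrix, Matrix.of_apply, upMap_apply]
  rw [sum_kSubspace (fun W => (if W ⊓ U.1 = ⊥ then (1 : ℝ) else 0) *
    ∑ T ∈ {T : Submodule F V | finrank F T = j}, if T ≤ W then h T else 0)]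
  simp only [Finset.mul_sum, Finset.sum_mul]
  rw [Finset.sum_comm]
  refine Finset.sum_congr rfl fun T hT => ?_
  simp only [mem_filter, mem_univ, true_and] at hT
  have : ∀ W : Submodule F V, ((if W ⊓ U.1 = ⊥ then (1 : ℝ) else 0) * if T ≤ W then h T else 0) =
      h T * if T ≤ W ∧ W ≤ ⊤ ∧ W ⊓ U.1 = ⊥ then 1 else 0 := by
    intro W
    by_cases h1 : W ⊓ U.1 = ⊥ <;> by_cases h2 : T ≤ W <;> simp [h1, h2]
  simp only [this]
  rw [← Finset.mul_sum, Finset.sum_boole, Finset.filter_filter]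
  split_ifs with hTU
  · rw [card_extensions ⊤ U.1 le_top k T le_top hTU (by omega), hT, U.2, finrank_top]
  · rw [zero_mul, Finset.filter_eq_empty_iff.2, card_empty, Nat.cast_zero, mul_zero]
    rintro W - ⟨-, h1, -, h2⟩
    exact hTU (le_bot_iff.1 (h2 ▸ inf_le_inf_right _ h1))

lemma sum_upMap_harmonic {k j : ℕ} [Fintype (KSubspace F V k)] (hj : 0 < j) (hjk : j ≤ k)
    {h : Submodule F V → ℝ} (hh : h ∈ harmonicFunctions F V j) :
    ∑ U, upMap F V j k h U = 0 := by
  simp only [upMap_apply]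
  rw [sum_kSubspace (fun W => ∑ T ∈ {T : Submodule F V | finrank F T = j}, if T ≤ W then h T else 0),
    Finset.sum_comm]
  have h0 := hh ⊥ (by simpa using hj)
  simp only [bot_le, if_true] at h0
  refine Eq.trans ?_ (mul_eq_zero_of_right (extensionCount (Nat.card F) (finrank F V) k 0 j) h0)
  rw [Finset.mul_sum]
  refine Finset.sum_congr rfl fun T hT => ?_
  simp only [mem_filter, mem_univ, true_and] at hT
  rw [← Finset.sum_filter, Finset.sum_const, Finset.filter_filter, nsmul_eq_mul]
  have := card_extensions ⊤ ⊥ le_top k T le_top (by simp) (by omega)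
  rw [hT, finrank_top, finrank_bot] at this
  rw [← this]
  simp

/-- The span of the functions `U ↦ [P ≤ U]` on `k`-subspaces, with `P` a `j`-subspace, is the range
of `upMap`. It is generated by harmonic functions of degree at most `j`. -/
lemma range_upMap_le {k : ℕ} (j : ℕ) (hjk : j ≤ k) :
    LinearMap.range (upMap F V j k) ≤
      ⨆ i ∈ Finset.range (j + 1), (harmonicFunctions F V i).map (upMap F V i k) := by
  induction j using Nat.strong_induction_on with
  | _ j ih =>
  -- the span of the indicators of the `j`-subspaces through a subspace of smaller dimension
  let ind : Submodule F V → Submodule F V → ℝ := fun P T =>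
    if finrank F T = j ∧ P ≤ T then 1 else 0
  let R : Submodule ℝ (EuclideanSpace ℝ (Submodule F V)) :=
    Submodule.span ℝ ((fun P => WithLp.toLp 2 (ind P)) '' {P | finrank F P < j})
  have hR : ∀ y ∈ R, upMap F V j k y.ofLp ∈
      ⨆ i ∈ Finset.range (j + 1), (harmonicFunctions F V i).map (upMap F V i k) := by
    intro y hy
    induction hy using Submodule.span_induction with
    | zero => simp
    | add x y _ _ hx hy => rw [WithLp.ofLp_add, map_add]; exact add_mem hx hy
    | smul a x _ hx => rw [WithLp.ofLp_smul, map_smul]; exact Submodule.smul_mem _ _ hx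
    | mem x hx =>
      obtain ⟨P, hP, rfl⟩ := hx
      have hP : finrank F P < j := hP
      have hle : (⨆ i ∈ Finset.range (finrank F P + 1), (harmonicFunctions F V i).map (upMap F V i k)) ≤
          ⨆ i ∈ Finset.range (j + 1), (harmonicFunctions F V i).map (upMap F V i k) :=
        biSup_mono fun i hi => by simp only [Finset.mem_range] at hi ⊢; omega
      apply hle
      apply ih _ hP (by omega)
      -- Lifting the indicator of the `j`-subspaces through `P` counts those between `P` and `U`.
      -- This is a constant times `[P ≤ U]`, hence a lift from degree `dim P`.
      refine ⟨fun T => if T = P then extensionCount (Nat.card F) k j 0 (finrank F P) else 0, ?_⟩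
      ext U
      rw [upMap_apply, upMap_apply, Finset.sum_eq_single P, if_pos rfl]
      · split_ifs with hPU
        · have := card_extensions U.1 ⊥ bot_le j P hPU (by simp) hP.le
          rw [U.2, finrank_bot] at this
          rw [← this, ← Finset.sum_filter, Finset.filter_filter]
          simp only [ind]
          rw [Finset.sum_boole, Finset.filter_filter]
          congr 2
          ext T
          simp only [mem_filter, mem_univ, true_and, inf_bot_eq]
          tauto
        · symm
          refine Finset.sum_eq_zero fun T _ => ?_
          simp only [ind]
          split_ifs with h1 h2
          · exact absurd (h2.2.trans h1) hPU
          · rfl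
          · rfl
      · intro T _ hT
        simp [hT]
      · intro hn
        simp at hn
  rintro _ ⟨h, rfl⟩
  let x : EuclideanSpace ℝ (Submodule F V) := WithLp.toLp 2 h
  -- Orthogonality to `R` is exactly the system of equations defining harmonic functions of degree
  -- `j`.
  obtain ⟨y, hy, z, hz, hxyz⟩ := R.exists_add_mem_mem_orthogonal x
  have hh : h = y.ofLp + z.ofLp := by
    rw [← WithLp.ofLp_add, ← hxyz]
  rw [hh, map_add]
  refine add_mem (hR y hy) ?_
  have hmem : j ∈ Finset.range (j + 1) := by simp
  apply Submodule.mem_iSup_of_mem j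
  apply Submodule.mem_iSup_of_mem hmem
  refine Submodule.mem_map_of_mem fun P hP => ?_
  have := (Submodule.mem_orthogonal R z).1 hz _ (Submodule.subset_span ⟨P, hP, rfl⟩)
  rw [PiLp.inner_apply] at this
  rw [Finset.sum_filter]
  refine Eq.trans (Finset.sum_congr rfl fun T _ => ?_) this
  simp only [ind]
  by_cases h1 : finrank F T = j <;> by_cases h2 : P ≤ T <;> simp [h1, h2]

lemma iSup_map_harmonic (k : ℕ) :
    ⨆ i ∈ Finset.range (k + 1), (harmonicFunctions F V i).map (upMap F V i k) = ⊤ := by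
  refine top_le_iff.1 (le_trans ?_ (range_upMap_le k le_rfl))
  rintro f -
  refine ⟨fun T => if h : finrank F T = k then f ⟨T, h⟩ else 0, ?_⟩
  ext U
  rw [upMap_apply, Finset.sum_eq_single U.1]
  · simp [U.2]
  · intro T hT hTU
    simp only [mem_filter, mem_univ, true_and] at hT
    rw [if_neg]
    intro hle
    exact hTU (Submodule.eq_of_le_of_finrank_eq hle (hT.trans U.2.symm))
  · intro hn
    simp [U.2] at hn

end Harmonic

/-! ### Symmetric matrices with a spanning family of eigenspaces -/

section Spectral

variable {n : Type*} [Fintype n]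

/-- An eigenvector with negative eigenvalue would be orthogonal to every `E i`, hence to the whole
space. -/
lemma posSemidef_of_iSup_eigenspaces [DecidableEq n] {M : Matrix n n ℝ} (hM : M.IsHermitian)
    {s : Finset ℕ} {E : ℕ → Submodule ℝ (n → ℝ)} (hE : ⨆ i ∈ s, E i = ⊤) {μ : ℕ → ℝ}
    (hμ : ∀ i ∈ s, 0 ≤ μ i) (hEM : ∀ i ∈ s, ∀ f ∈ E i, M.mulVec f = μ i • f) :
    M.PosSemidef := by
  rw [hM.posSemidef_iff_eigenvalues_nonneg]
  intro a
  by_contra hlt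
  simp only [Pi.zero_apply, not_le] at hlt
  have hx := hM.mulVec_eigenvectorBasis a
  set x : n → ℝ := (hM.eigenvectorBasis a).ofLp with hxdef
  have hall : ∀ f ∈ (⊤ : Submodule ℝ (n → ℝ)), x ⬝ᵥ f = 0 := by
    rw [← hE]
    have : (⨆ i ∈ s, E i) ≤ LinearMap.ker (dotProductBilin ℝ ℝ x) := by
      refine iSup₂_le fun i hi f hf => ?_
      rw [LinearMap.mem_ker]
      change x ⬝ᵥ f = 0
      have h1 : x ⬝ᵥ M.mulVec f = M.mulVec x ⬝ᵥ f := by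
        rw [Matrix.dotProduct_mulVec, ← Matrix.mulVec_transpose]
        congr 2
      rw [hEM i hi f hf, hx, dotProduct_smul, smul_dotProduct, smul_eq_mul, smul_eq_mul] at h1
      have := hμ i hi
      by_contra hne
      have := mul_right_cancel₀ hne h1
      linarith
    exact fun f hf => this hf
  have h0 : x = 0 := dotProduct_self_eq_zero.1 (hall x trivial)
  have := (hM.eigenvectorBasis.orthonormal).ne_zero a
  exact this (by ext i; exact congrFun h0 i)

/-- Let `g` be the part of `f` with nonzero eigenvalues. Then `M g = 0`, so symmetry makes `g`
orthogonal to each of its own summands, whence `g = 0`. -/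
lemma mem_iSup_of_mulVec_eq_zero {M : Matrix n n ℝ} (hM : M.IsHermitian)
    {s : Finset ℕ} {E : ℕ → Submodule ℝ (n → ℝ)} (hE : ⨆ i ∈ s, E i = ⊤) {μ : ℕ → ℝ}
    (hEM : ∀ i ∈ s, ∀ f ∈ E i, M.mulVec f = μ i • f) {K : Submodule ℝ (n → ℝ)}
    (hK : ∀ i ∈ s, μ i = 0 → E i ≤ K) {f : n → ℝ} (hf : M.mulVec f = 0) : f ∈ K := by
  have hftop : f ∈ ⨆ i ∈ s, E i := hE ▸ trivial
  obtain ⟨e, he⟩ := (Submodule.mem_iSup_finset_iff_exists_sum _ f).1 hftop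
  set z : n → ℝ := ∑ i ∈ s with μ i = 0, (e i : n → ℝ)
  set g : n → ℝ := ∑ i ∈ s with ¬ μ i = 0, (e i : n → ℝ)
  have hzg : f = z + g := by rw [← he, Finset.sum_filter_add_sum_filter_not]
  have hzK : z ∈ K := by
    refine Submodule.sum_mem _ fun i hi => ?_
    simp only [mem_filter] at hi
    exact hK i hi.1 hi.2 (e i).2
  have hMz : M.mulVec z = 0 := by
    rw [Matrix.mulVec_sum]
    refine Finset.sum_eq_zero fun i hi => ?_
    simp only [mem_filter] at hi
    rw [hEM i hi.1 _ (e i).2, hi.2, zero_smul]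
  have hMg : M.mulVec g = 0 := by
    rw [hzg, Matrix.mulVec_add, hMz, zero_add] at hf
    exact hf
  have hgg : g ⬝ᵥ g = 0 := by
    nth_rw 2 [show g = ∑ i ∈ s with ¬ μ i = 0, (e i : n → ℝ) from rfl]
    rw [dotProduct_sum]
    refine Finset.sum_eq_zero fun i hi => ?_
    simp only [mem_filter] at hi
    have h1 : g ⬝ᵥ M.mulVec (e i) = M.mulVec g ⬝ᵥ e i := by
      rw [Matrix.dotProduct_mulVec, ← Matrix.mulVec_transpose]
      congr 2
    rw [hEM i hi.1 _ (e i).2, hMg, zero_dotProduct, dotProduct_smul, smul_eq_mul] at h1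
    exact (mul_eq_zero.1 h1).resolve_left hi.2
  rw [hzg, dotProduct_self_eq_zero.1 hgg, add_zero]
  exact hzK

end Spectral

/-! ### Eigenvalue estimates and Gaussian binomials -/

section Numerics

lemma extensionCount_pos {q v k u : ℕ} (hq : 1 < (q : ℝ)) (hv : k + u ≤ v) (j : ℕ) :
    0 < extensionCount q v k u j := by
  refine Finset.prod_pos fun i hi => ?_
  rw [Finset.mem_Ico] at hi
  exact div_pos (sub_pos.2 (pow_lt_pow_right₀ hq (by omega)))
    (sub_pos.2 (pow_lt_pow_right₀ hq hi.2))

/-- After cancellation the claim is `q^(j+k) - q^(2j) < q^v - q^(j+k)`. It follows from `2 q^(j+k) ≤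
q^(j+k+1) ≤ q^v`, where `j < k` and `2k ≤ v` enter. -/
lemma pow_mul_extensionCount_succ_lt {q v k j : ℕ} (hq : 2 ≤ (q : ℝ)) (hv : 2 * k ≤ v)
    (hj : j < k) : (q : ℝ) ^ j * extensionCount q v k k (j + 1) < extensionCount q v k k j := by
  have hq1 : 1 < (q : ℝ) := by linarith
  have h := extensionCount_succ hq1 v k hj
  have hpos := extensionCount_pos hq1 (by omega : k + k ≤ v) (j + 1)
  have hd : 0 < (q : ℝ) ^ k - (q : ℝ) ^ j := sub_pos.2 (pow_lt_pow_right₀ hq1 hj)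
  have h1 : 2 * (q : ℝ) ^ (j + k) ≤ (q : ℝ) ^ v :=
    calc 2 * (q : ℝ) ^ (j + k) ≤ q * (q : ℝ) ^ (j + k) := by gcongr
      _ = (q : ℝ) ^ (j + k + 1) := by rw [pow_succ']
      _ ≤ (q : ℝ) ^ v := pow_le_pow_right₀ hq1.le (by omega)
  have h2 : 0 < (q : ℝ) ^ (j + j) := by positivity
  refine lt_of_mul_lt_mul_right ?_ hd.le
  rw [h, mul_comm ((q : ℝ) ^ j), mul_assoc]
  refine mul_lt_mul_of_pos_left ?_ hpos
  rw [mul_sub, ← pow_add, ← pow_add]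
  linarith

lemma pow_choose_mul_extensionCount_lt {q v k j : ℕ} (hq : 2 ≤ (q : ℝ)) (hv : 2 * k ≤ v)
    (hj : 2 ≤ j) (hjk : j ≤ k) :
    (q : ℝ) ^ (j.choose 2) * extensionCount q v k k j < extensionCount q v k k 1 := by
  induction j, hj using Nat.le_induction with
  | base => simpa using pow_mul_extensionCount_succ_lt hq hv (j := 1) (by omega)
  | succ j hj ih =>
    refine lt_trans ?_ (ih (by omega))
    rw [Nat.choose_succ_succ' j 1, Nat.choose_one_right, add_comm j, pow_add, mul_assoc]
    have : 0 < (q : ℝ) := by linarith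
    exact mul_lt_mul_of_pos_left (pow_mul_extensionCount_succ_lt hq hv (by omega)) (by positivity)

lemma subspaceMoebius_mul_extensionCount_add_pos {q v k j : ℕ} (hq : 2 ≤ (q : ℝ))
    (hv : 2 * k ≤ v) (hj : 2 ≤ j) (hjk : j ≤ k) :
    0 < subspaceMoebius q j * extensionCount q v k k j + extensionCount q v k k 1 := by
  have h := pow_choose_mul_extensionCount_lt hq hv hj hjk
  have hpos := extensionCount_pos (by linarith) (by omega : k + k ≤ v) j
  have : 0 < (q : ℝ) ^ (j.choose 2) * extensionCount q v k k j :=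
    mul_pos (pow_pos (by linarith) _) hpos
  rw [subspaceMoebius]
  rcases neg_one_pow_eq_or ℝ j with h1 | h1 <;> rw [h1] <;> linarith

lemma qFactorial_ne_zero {q : ℕ} (hq : 1 < q) (n : ℕ) : qFactorial q n ≠ 0 := by
  have hq' : (1 : ℚ) < q := by exact_mod_cast hq
  induction n with
  | zero => simp [qFactorial]
  | succ n ih =>
    exact mul_ne_zero (div_pos (sub_pos.2 (one_lt_pow₀ hq' (by omega))) (sub_pos.2 hq')).ne' ih

lemma qBinomial_succ_succ {q : ℕ} (hq : 1 < q) (n m : ℕ) :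
    qBinomial q (n + 1) (m + 1) * ((q : ℚ) ^ (m + 1) - 1) =
      qBinomial q n m * ((q : ℚ) ^ (n + 1) - 1) := by
  have hq' : (1 : ℚ) < q := by exact_mod_cast hq
  have h1 := qFactorial_ne_zero hq m
  have h2 := qFactorial_ne_zero hq (n - m)
  have h3 : (q : ℚ) - 1 ≠ 0 := (sub_pos.2 hq').ne'
  have h4 : (q : ℚ) ^ (m + 1) - 1 ≠ 0 := (sub_pos.2 (one_lt_pow₀ hq' (by omega))).ne'
  rw [qBinomial, qBinomial, Nat.add_sub_add_right, qFactorial, qFactorial, qInt, qInt]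
  field_simp

/-- Peeling off the first factor raises the lower index `j`, so the induction needs all `j` at once.
Passing to the quotient by the `j`-subspace corresponds to cancelling `q^j`. -/
lemma extensionCount_eq_qBinomial {q : ℕ} (hq : 1 < q) (n m j : ℕ) :
    extensionCount q (n + m + j) (m + j) 0 j = (qBinomial q (n + m) m : ℝ) := by
  have hq' : (1 : ℝ) < q := by exact_mod_cast hq
  induction m generalizing j with
  | zero =>
    rw [zero_add, extensionCount_self, qBinomial]
    simp [qFactorial, div_self (qFactorial_ne_zero hq n)]
  | succ m ih =>
    have h := extensionCount_succ hq' (n + (m + 1) + j) 0 (by omega : j < m + 1 + j)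
    have h2 := ih (j + 1)
    rw [show n + m + (j + 1) = n + (m + 1) + j by ring, show m + (j + 1) = m + 1 + j by ring] at h2
    rw [h2] at h
    have h3 : (qBinomial q (n + m + 1) (m + 1) : ℝ) * ((q : ℝ) ^ (m + 1) - 1) =
        (qBinomial q (n + m) m : ℝ) * ((q : ℝ) ^ (n + m + 1) - 1) := by
      exact_mod_cast congrArg (Rat.cast : ℚ → ℝ) (qBinomial_succ_succ hq (n + m) m)
    have hpos : (q : ℝ) ^ (m + 1) - 1 ≠ 0 := (sub_pos.2 (one_lt_pow₀ hq' (by omega))).ne'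
    have hj : (q : ℝ) ^ j ≠ 0 := pow_ne_zero _ (by linarith)
    apply mul_right_cancel₀ hpos
    apply mul_right_cancel₀ hj
    rw [add_assoc n m 1] at h3
    rw [h3]
    rw [add_zero, pow_add _ (n + (m + 1)), pow_add _ (m + 1) j] at h
    linear_combination h

end Numerics

/-! ### The ratio bound and its equality case -/

section Ratio

variable {F V : Type*} [Field F] [Finite F] [AddCommGroup V] [Module F V] [FiniteDimensional F V]
  [Fintype (Submodule F V)]

lemma two_le_natCard_real (F : Type*) [Field F] [Finite F] : (2 : ℝ) ≤ (Nat.card F : ℝ) := by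
  exact_mod_cast Finite.one_lt_card (α := F)

lemma card_kSubspace {k : ℕ} [Fintype (KSubspace F V k)] :
    (Fintype.card (KSubspace F V k) : ℝ) = extensionCount (Nat.card F) (finrank F V) k 0 0 := by
  have := card_extensions ⊤ ⊥ le_top k (⊥ : Submodule F V) bot_le (by simp) (by simp)
  rw [finrank_top, finrank_bot] at this
  rw [← this, Fintype.card_subtype]
  simp

lemma card_kSubspace_through {k : ℕ} [Fintype (KSubspace F V k)] (hk : 1 ≤ k)
    {L : Submodule F V} (hL : finrank F L = 1) :
    (#{U : KSubspace F V k | L ≤ U.1} : ℝ) =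
      extensionCount (Nat.card F) (finrank F V) k 0 1 := by
  have := card_extensions ⊤ ⊥ le_top k L le_top (by simp) (by omega)
  rw [finrank_top, finrank_bot, hL] at this
  rw [← this, ← Finset.sum_boole, sum_kSubspace (fun U => if L ≤ U then (1 : ℝ) else 0),
    Finset.sum_boole, Finset.filter_filter]
  simp

omit [Finite F] [FiniteDimensional F V] in
lemma range_upMap_one_le (k : ℕ) :
    LinearMap.range (upMap F V 1 k) ≤ columnSpace (inclusionMatrix F V k).transpose := by
  rintro _ ⟨h, rfl⟩
  have : Fintype (KSubspace F V 1) := Fintype.ofFinite _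
  have heq : upMap F V 1 k h =
      ∑ L : KSubspace F V 1, h L.1 • (inclusionMatrix F V k).transpose.col L := by
    ext U
    rw [upMap_apply, Finset.sum_apply,
      ← sum_kSubspace (fun T => if T ≤ U.1 then h T else 0)]
    refine Finset.sum_congr rfl fun L _ => ?_
    simp [inclusionMatrix]
  rw [heq]
  exact Submodule.sum_mem _ fun L _ =>
    Submodule.smul_mem _ _ (Submodule.subset_span ⟨L, rfl⟩)

omit [Finite F] in
lemma upMap_zero_apply (k : ℕ) (h : Submodule F V → ℝ) (U : KSubspace F V k) :
    upMap F V 0 k h U = h ⊥ := by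
  rw [upMap_apply, Finset.sum_eq_single ⊥]
  · simp
  · intro T hT hne
    simp only [mem_filter, mem_univ, true_and] at hT
    exact absurd (Submodule.finrank_eq_zero.1 hT) hne
  · intro hn
    simp at hn

/-- Lifts from degree 0 are constants, and all `k`-subspaces contain the same number of lines. -/
lemma range_upMap_zero_le {k : ℕ} (hk : 1 ≤ k) :
    LinearMap.range (upMap F V 0 k) ≤ LinearMap.range (upMap F V 1 k) := by
  rintro _ ⟨h, rfl⟩
  have hpos : extensionCount (Nat.card F) k 1 0 0 ≠ 0 :=
    (extensionCount_pos (one_lt_natCard_real F) (by omega) 0).ne'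
  refine ⟨fun _ => h ⊥ / extensionCount (Nat.card F) k 1 0 0, ?_⟩
  ext U
  rw [upMap_zero_apply, upMap_apply, ← Finset.sum_filter, Finset.sum_const, nsmul_eq_mul,
    Finset.filter_filter]
  have := card_extensions U.1 ⊥ bot_le 1 (⊥ : Submodule F V) bot_le (by simp) (by simp)
  rw [U.2, finrank_bot] at this
  simp only [bot_le, inf_bot_eq, and_true, true_and] at this
  rw [this]
  field_simp

/-- The matrix of the ratio bound: its quadratic form is nonnegative, and its kernel consists of
the first two eigenspaces of the disjointness matrix. -/
noncomputable def ratioMatrix (F V : Type*) [Field F] [AddCommGroup V] [Module F V] (k : ℕ) :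
    Matrix (KSubspace F V k) (KSubspace F V k) ℝ :=
  disjointMatrix F V k + extensionCount (Nat.card F) (finrank F V) k k 1 • 1 -
    (extensionCount (Nat.card F) (finrank F V) k k 1 /
      extensionCount (Nat.card F) (finrank F V) k 0 1) • Matrix.of fun _ _ => 1

variable {k : ℕ} [Fintype (KSubspace F V k)]

omit [Finite F] [FiniteDimensional F V] [Fintype (Submodule F V)] in
lemma ratioMatrix_mulVec (f : KSubspace F V k → ℝ) (U : KSubspace F V k) :
    (ratioMatrix F V k).mulVec f U = (disjointMatrix F V k).mulVec f U +
      extensionCount (Nat.card F) (finrank F V) k k 1 * f U -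
      (extensionCount (Nat.card F) (finrank F V) k k 1 /
        extensionCount (Nat.card F) (finrank F V) k 0 1) * ∑ W, f W := by
  rw [ratioMatrix, Matrix.sub_mulVec, Matrix.add_mulVec, Matrix.smul_mulVec, Matrix.smul_mulVec,
    Matrix.one_mulVec]
  simp [Matrix.mulVec, dotProduct]

omit [Finite F] [FiniteDimensional F V] [Fintype (Submodule F V)] [Fintype (KSubspace F V k)] in
lemma ratioMatrix_isHermitian : (ratioMatrix F V k).IsHermitian := by
  ext U W
  simp only [ratioMatrix, disjointMatrix, Matrix.conjTranspose_apply, Matrix.sub_apply,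
    Matrix.add_apply, Matrix.smul_apply, Matrix.of_apply, Matrix.one_apply, star_trivial,
    inf_comm U.1 W.1, eq_comm (a := U) (b := W)]

/-- The eigenvalues of `ratioMatrix`. -/
noncomputable def ratioEigenvalue (q v k j : ℕ) : ℝ :=
  if j = 0 then 0 else subspaceMoebius q j * extensionCount q v k k j + extensionCount q v k k 1

lemma ratioEigenvalue_one (q v k : ℕ) : ratioEigenvalue q v k 1 = 0 := by
  simp [ratioEigenvalue, subspaceMoebius]

lemma ratioEigenvalue_pos {q v k j : ℕ} (hq : 2 ≤ (q : ℝ)) (hv : 2 * k ≤ v) (hj : 2 ≤ j)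
    (hjk : j ≤ k) : 0 < ratioEigenvalue q v k j := by
  rw [ratioEigenvalue, if_neg (by omega)]
  exact subspaceMoebius_mul_extensionCount_add_pos hq hv hj hjk

lemma ratioMatrix_mulVec_upMap (hk : 1 ≤ k) (hv : 2 * k ≤ finrank F V) {j : ℕ} (hj : j ≤ k)
    {h : Submodule F V → ℝ} (hh : h ∈ harmonicFunctions F V j) :
    (ratioMatrix F V k).mulVec (upMap F V j k h) =
      ratioEigenvalue (Nat.card F) (finrank F V) k j • upMap F V j k h := by
  ext U
  rw [ratioMatrix_mulVec, disjointMatrix_mulVec hj hh, Pi.smul_apply, Pi.smul_apply, smul_eq_mul,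
    smul_eq_mul, ratioEigenvalue]
  split_ifs with h0
  · subst h0
    simp only [upMap_zero_apply, Finset.sum_const, card_univ, nsmul_eq_mul, card_kSubspace]
    have hq := one_lt_natCard_real F
    have h1 := extensionCount_succ hq (finrank F V) k (by omega : 0 < k)
    have h2 := extensionCount_succ hq (finrank F V) 0 (by omega : 0 < k)
    have h3 := (extensionCount_pos hq (by omega : k + 0 ≤ finrank F V) 1).ne'
    have h4 : (Nat.card F : ℝ) ^ k - 1 ≠ 0 := (sub_pos.2 (one_lt_pow₀ hq (by omega))).ne'
    simp only [zero_add, pow_zero] at h1 h2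
    rw [show subspaceMoebius (Nat.card F) 0 = 1 by simp [subspaceMoebius]]
    field_simp
    apply mul_right_cancel₀ h4
    -- With `d` the valency and `N` the number of vertices, `h1` and `h2` give `d + τ = τ (q^v -
    -- 1)/(q^k - 1) = (τ/c) N`.
    linear_combination (extensionCount (Nat.card F) (finrank F V) k 0 1 * h ⊥) * h1 -
      (extensionCount (Nat.card F) (finrank F V) k k 1 * h ⊥) * h2
  · rw [sum_upMap_harmonic (by omega) hj hh]
    ring

lemma ratioMatrix_posSemidef (hk : 1 ≤ k) (hv : 2 * k ≤ finrank F V) :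
    (ratioMatrix F V k).PosSemidef := by
  refine posSemidef_of_iSup_eigenspaces ratioMatrix_isHermitian (iSup_map_harmonic k)
    (μ := ratioEigenvalue (Nat.card F) (finrank F V) k) (fun j hj => ?_) ?_
  · rw [Finset.mem_range] at hj
    obtain rfl | rfl | hj2 : j = 0 ∨ j = 1 ∨ 2 ≤ j := by omega
    · simp [ratioEigenvalue]
    · rw [ratioEigenvalue_one]
    · exact (ratioEigenvalue_pos (two_le_natCard_real F) hv hj2 (by omega)).le
  · rintro j hj _ ⟨h, hh, rfl⟩
    rw [Finset.mem_range] at hj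
    exact ratioMatrix_mulVec_upMap hk hv (by omega) hh

lemma mem_columnSpace_of_ratioMatrix_mulVec_eq_zero (hk : 1 ≤ k) (hv : 2 * k ≤ finrank F V)
    {f : KSubspace F V k → ℝ} (hf : (ratioMatrix F V k).mulVec f = 0) :
    f ∈ columnSpace (inclusionMatrix F V k).transpose := by
  refine mem_iSup_of_mulVec_eq_zero ratioMatrix_isHermitian (iSup_map_harmonic k)
    (μ := ratioEigenvalue (Nat.card F) (finrank F V) k) ?_ (fun j hj hj0 => ?_) hf
  · rintro j hj _ ⟨h, hh, rfl⟩
    rw [Finset.mem_range] at hj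
    exact ratioMatrix_mulVec_upMap hk hv (by omega) hh
  · rw [Finset.mem_range] at hj
    refine le_trans LinearMap.map_le_range ?_
    obtain rfl | rfl | hj2 : j = 0 ∨ j = 1 ∨ 2 ≤ j := by omega
    · exact (range_upMap_zero_le hk).trans (range_upMap_one_le k)
    · exact range_upMap_one_le k
    · exact absurd hj0 (ratioEigenvalue_pos (two_le_natCard_real F) hv hj2 (by omega)).ne'

lemma charVector_dotProduct {α : Type*} [Fintype α] (S : Finset α) (f : α → ℝ) :
    charVector S ⬝ᵥ f = ∑ a ∈ S, f a := by
  rw [dotProduct, ← Finset.sum_subset (Finset.subset_univ S)]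
  · exact Finset.sum_congr rfl fun a ha => by simp [charVector, ha]
  · intro a _ ha
    simp [charVector, ha]

omit [Finite F] [FiniteDimensional F V] [Fintype (Submodule F V)] in
lemma charVector_ratioMatrix (hk : 1 ≤ k) {S : Finset (KSubspace F V k)}
    (hS : (qKneserGraph F V k).IsIndepSet (S : Set (KSubspace F V k))) :
    charVector S ⬝ᵥ (ratioMatrix F V k).mulVec (charVector S) =
      extensionCount (Nat.card F) (finrank F V) k k 1 * #S -
      (extensionCount (Nat.card F) (finrank F V) k k 1 /
        extensionCount (Nat.card F) (finrank F V) k 0 1) * (#S : ℝ) ^ 2 := by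
  have hsum : ∑ W, charVector S W = (#S : ℝ) := by
    have := charVector_dotProduct S (fun _ => 1)
    simpa [dotProduct] using this
  rw [charVector_dotProduct, Finset.sum_congr rfl
    (g := fun _ => extensionCount (Nat.card F) (finrank F V) k k 1 -
      (extensionCount (Nat.card F) (finrank F V) k k 1 /
        extensionCount (Nat.card F) (finrank F V) k 0 1) * (#S : ℝ))]
  · rw [Finset.sum_const, nsmul_eq_mul]
    ring
  intro U hU
  have hA : (disjointMatrix F V k).mulVec (charVector S) U = 0 := by
    rw [Matrix.mulVec, dotProduct_comm, charVector_dotProduct]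
    refine Finset.sum_eq_zero fun W hW => ?_
    rw [disjointMatrix, Matrix.of_apply, if_neg]
    intro hWU
    -- On the diagonal, `U ⊓ U = ⊥` is excluded by `k ≥ 1`.
    by_cases hne : U = W
    · subst hne
      rw [inf_idem] at hWU
      have := U.2
      rw [hWU, finrank_bot] at this
      omega
    · exact hS hU hW hne ⟨hne, by rw [inf_comm]; exact hWU⟩
  rw [ratioMatrix_mulVec, hA, hsum]
  simp [charVector, hU]

lemma card_le_of_isIndepSet (hk : 1 ≤ k) (hv : 2 * k ≤ finrank F V)
    {S : Finset (KSubspace F V k)}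
    (hS : (qKneserGraph F V k).IsIndepSet (S : Set (KSubspace F V k))) :
    (#S : ℝ) ≤ extensionCount (Nat.card F) (finrank F V) k 0 1 := by
  have h := (ratioMatrix_posSemidef hk hv).dotProduct_mulVec_nonneg (charVector S)
  rw [star_trivial, charVector_ratioMatrix hk hS] at h
  have hq := one_lt_natCard_real F
  have h1 := extensionCount_pos hq (by omega : k + k ≤ finrank F V) 1
  have h2 := extensionCount_pos hq (by omega : k + 0 ≤ finrank F V) 1
  rcases (Nat.cast_nonneg (#S) : (0 : ℝ) ≤ #S).eq_or_lt with h0 | h0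
  · rw [← h0]
    exact h2.le
  by_contra! hlt
  have h3 : 1 < (#S : ℝ) / extensionCount (Nat.card F) (finrank F V) k 0 1 :=
    (one_lt_div h2).2 hlt
  have h4 := mul_lt_mul_of_pos_left h3 (mul_pos h1 h0)
  rw [mul_one] at h4
  refine absurd h (not_le.2 ?_)
  rw [sub_neg]
  exact h4.trans_eq (by ring)

/-- At equality the quadratic form vanishes, and for a positive semidefinite matrix this puts the
vector in the kernel. -/
lemma charVector_mem_columnSpace (hk : 1 ≤ k) (hv : 2 * k ≤ finrank F V)
    {S : Finset (KSubspace F V k)}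
    (hS : (qKneserGraph F V k).IsIndepSet (S : Set (KSubspace F V k)))
    (hcard : (#S : ℝ) = extensionCount (Nat.card F) (finrank F V) k 0 1) :
    charVector S ∈ columnSpace (inclusionMatrix F V k).transpose := by
  apply mem_columnSpace_of_ratioMatrix_mulVec_eq_zero hk hv
  rw [← (ratioMatrix_posSemidef hk hv).dotProduct_mulVec_zero_iff, star_trivial,
    charVector_ratioMatrix hk hS, hcard]
  have h2 := (extensionCount_pos (one_lt_natCard_real F) (by omega : k + 0 ≤ finrank F V) 1).ne'
  field_simp
  ring

lemma indepNum_eq (hk : 1 ≤ k) (hv : 2 * k ≤ finrank F V) :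
    ((qKneserGraph F V k).indepNum : ℝ) =
      extensionCount (Nat.card F) (finrank F V) k 0 1 := by
  apply le_antisymm
  · obtain ⟨S, hS⟩ := (qKneserGraph F V k).exists_isNIndepSet_indepNum
    rw [← hS.card_eq]
    exact card_le_of_isIndepSet hk hv hS.isIndepSet
  · obtain ⟨x, hx⟩ := (Module.finrank_pos_iff_exists_ne_zero (R := F) (M := V)).1 (by omega)
    have hL : finrank F (F ∙ x) = 1 := finrank_span_singleton hx
    rw [← card_kSubspace_through hk hL]
    norm_cast
    apply SimpleGraph.IsIndepSet.card_le_indepNum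
    intro U hU W hW _ hadj
    simp only [coe_filter, mem_univ, true_and, Set.mem_ofPred_eq] at hU hW
    have h0 := le_inf hU hW
    rw [hadj.2, le_bot_iff, Submodule.span_singleton_eq_bot] at h0
    exact hx h0

end Ratio

end Auxiliary

theorem mainTheorem4 {F V : Type*} [Field F] [Finite F] [AddCommGroup V] [Module F V]
    [FiniteDimensional F V] (q v k : ℕ) (hq : Nat.card F = q) (hv : Module.finrank F V = v)
    (hk : 1 ≤ k) (hvk : 2 * k ≤ v) :
    ((qKneserGraph F V k).indepNum : ℚ) = qBinomial q (v - 1) (k - 1) ∧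
      ∀ S : Finset (KSubspace F V k), (qKneserGraph F V k).IsIndepSet (S : Set (KSubspace F V k)) →
        (S.card : ℚ) = qBinomial q (v - 1) (k - 1) →
          charVector S ∈ columnSpace (inclusionMatrix F V k).transpose := by
  subst hq hv
  have : Finite V := Module.finite_of_finite F
  have := Fintype.ofFinite (Submodule F V)
  have := Fintype.ofFinite (KSubspace F V k)
  have hbin : extensionCount (Nat.card F) (Module.finrank F V) k 0 1 =
      (qBinomial (Nat.card F) (Module.finrank F V - 1) (k - 1) : ℝ) := by
    have h := extensionCount_eq_qBinomial (Finite.one_lt_card (α := F))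
      (Module.finrank F V - k) (k - 1) 1
    rwa [show Module.finrank F V - k + (k - 1) + 1 = Module.finrank F V by omega,
      show k - 1 + 1 = k by omega,
      show Module.finrank F V - k + (k - 1) = Module.finrank F V - 1 by omega] at h
  refine ⟨?_, fun S hS hcard => charVector_mem_columnSpace hk hvk hS ?_⟩
  · have h := indepNum_eq (F := F) (V := V) hk hvk
    rw [hbin] at h
    exact_mod_cast h
  · rw [hbin, ← hcard]
    norm_cast
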